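/- Let $C$ be a convex subset of a real normed space $X$, let $T:C\to C$ and $T_n:C\to C$ ($n\ge 1$) be nonexpansive maps, and put $\rho_n=\sup\{\|T_nx-Tx\|:x\in C\}\in[0,\infty]$. Let $\alpha_n\in[0,1]$ for $n\ge 1$, $x_0\in C$, and let $(x_n)_{n\ge 0}$ be generated by the diagonal Krasnosel'skii--Mann iteration $$x_{n+1}=(1-\alpha_{n+1})\,x_n+\alpha_{n+1}\,T_{n+1}x_n\qquad(n\ge 0).$$ Let $\tau_n=\sum_{k=1}^n\alpha_k(1-\alpha_k)$ and $\sigma(y)=\min\{1,1/\sqrt{\pi y}\}$ for $y\ge 0$, with $\sigma(0)=1$. Suppose that $\rho_n\to 0$, $\sum_{k\ge 1}\alpha_k\rho_k<\infty$ (with $0\cdot\infty=0$), $\sum_{k\ge 1}\alpha_k(1-\alpha_k)=\infty$, and that for some $\kappa\ge 0$ we have $\|x_0-Tx_n\|\le\kappa$ for all $n\ge 0$. Then $\|x_n-Tx_n\|\to 0$ as $n\to\infty$, and for every $n\ge 0$ $$\|x_n-Tx_n\|\le \kappa\,\sigma(\tau_n)+\sum_{i=1}^n 2\alpha_i\rho_i\,\sigma(\tau_n-\tau_i)+2\rho_{n+1}.$$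 -/

import Mathlib

open Filter Topology
open scoped ENNReal

noncomputable section

namespace DiagKM

/-- The function `σ(y) = min {1, 1 / √(π y)}` on `[0, ∞)`, where `1 / 0 = +∞`, so that `σ(0) = 1`. -/
def sigma (y : ℝ) : ℝ :=
  if y = 0 then 1 else min 1 (1 / Real.sqrt (Real.pi * y))

/-- The partial sums `τ_n = ∑_{k=1}^n α_k (1 - α_k)`. -/
def tau (α : ℕ → ℝ) (n : ℕ) : ℝ :=
  ∑ k ∈ Finset.Icc 1 n, α k * (1 - α k)

/-- The uniform distance `sup {‖S x - T x‖ : x ∈ C}`, with values in `[0, ∞]`. -/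
def unifDist {E : Type*} [NormedAddCommGroup E] (C : Set E) (S T : E → E) : ℝ≥0∞ :=
  ⨆ x ∈ C, ENNReal.ofReal ‖S x - T x‖

/-- `x` is generated by the diagonal Krasnosel'skii-Mann iteration
`x_{n+1} = (1 - α_{n+1}) x_n + α_{n+1} T_{n+1} x_n`. -/
def IsDiagonalKM {E : Type*} [NormedAddCommGroup E] [NormedSpace ℝ E]
    (α : ℕ → ℝ) (Tseq : ℕ → E → E) (x : ℕ → E) : Prop :=
  ∀ n : ℕ, x (n + 1) = (1 - α (n + 1)) • x n + α (n + 1) • Tseq (n + 1) (x n)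

end DiagKM

end

/-! Convexity and nonexpansiveness bound the distances `‖x m - T (x n)‖` and `‖x m - x n‖`, `m ≤ n`,
by averages of earlier ones. An explicit solution of the recursion with equality therefore dominates
them (`IsDiagonalKM.norm_le_raceBound`). The unperturbed solution is the expected sign of a lazy
symmetric walk started at `1` (for `T (x n)`) or `0` (for `x n`) plus Bernoulli variables of
parameters `α_{m+1}, …, α_n`. A perturbation at step `i` acts as a fresh start there, with weight `2
e_i`. On the diagonal `m = n`, a Fourier integral for the expected sign is compared with a Gaussian,
giving `σ` (`meanSign_one_le`). Convergence follows by dominated convergence. -/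

namespace DiagKM

/-! ### Fourier form of the expected sign, and its recursions -/

/-- The kernel `sin (t θ) cot (θ / 2)`, written as a trigonometric polynomial. -/
noncomputable def signKernel (t : ℤ) (θ : ℝ) : ℝ :=
  (1 + Real.cos θ) * (Polynomial.Chebyshev.U ℝ (t - 1)).eval (Real.cos θ)

/-- The characteristic function of a sum of independent symmetric steps in `{-1, 0, 1}`, the `i`-th
of which is nonzero with probability `2 α_i (1 - α_i)`. -/
noncomputable def lazyCharFun (α : ℕ → ℝ) (m : ℕ) (θ : ℝ) : ℝ :=
  ∏ i ∈ Finset.Icc 1 m, (1 - 2 * (α i * (1 - α i)) * (1 - Real.cos θ))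

/-- The expected sign of the position after `m` steps of the lazy walk started at `t`. -/
noncomputable def meanSign (α : ℕ → ℝ) (m : ℕ) (t : ℤ) : ℝ :=
  Real.pi⁻¹ * ∫ θ in (0 : ℝ)..Real.pi, signKernel t θ * lazyCharFun α m θ

/-- `meanSign α m` averaged over the initial position `t + B`, where `B` is the sum of `k`
independent Bernoulli variables with parameters `α_{m+1}, …, α_{m+k}`. -/
noncomputable def raceProb (α : ℕ → ℝ) (m : ℕ) : ℕ → ℤ → ℝ
  | 0, t => meanSign α m t
  | k + 1, t => (1 - α (m + k + 1)) * raceProb α m k t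
      + α (m + k + 1) * raceProb α m k (t + 1)

lemma continuous_signKernel (t : ℤ) : Continuous (signKernel t) := by
  unfold signKernel; fun_prop

lemma continuous_lazyCharFun (α : ℕ → ℝ) (m : ℕ) : Continuous (lazyCharFun α m) := by
  unfold lazyCharFun; fun_prop

lemma signKernel_add_signKernel (t : ℤ) (θ : ℝ) :
    signKernel (t + 1) θ + signKernel (t - 1) θ = 2 * Real.cos θ * signKernel t θ := by
  have h := congrArg (Polynomial.eval (Real.cos θ)) (Polynomial.Chebyshev.U_add_two ℝ (t - 2))
  simp only [Polynomial.eval_sub, Polynomial.eval_mul, Polynomial.eval_X,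
    Polynomial.eval_ofNat] at h
  rw [show t - 2 + 2 = t by ring, show t - 2 + 1 = t - 1 by ring] at h
  simp only [signKernel]
  rw [show t + 1 - 1 = t by ring, show t - 1 - 1 = t - 2 by ring, h]
  ring

lemma signKernel_zero (θ : ℝ) : signKernel 0 θ = 0 := by
  simp [signKernel]

lemma signKernel_one (θ : ℝ) : signKernel 1 θ = 1 + Real.cos θ := by
  simp [signKernel]

lemma signKernel_add_one (t : ℤ) (θ : ℝ) :
    signKernel (t + 1) θ
      = signKernel t θ + (Real.cos (((t + 1 : ℤ) : ℝ) * θ) + Real.cos ((t : ℝ) * θ)) := by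
  have h1 := congrArg (Polynomial.eval (Real.cos θ))
    (Polynomial.Chebyshev.T_eq_X_mul_U_sub_U ℝ (t - 1))
  have h2 := congrArg (Polynomial.eval (Real.cos θ)) (Polynomial.Chebyshev.T_eq_U_sub_X_mul_U ℝ t)
  simp only [Polynomial.eval_sub, Polynomial.eval_mul, Polynomial.eval_X] at h1 h2
  rw [show t - 1 + 2 = t + 1 by ring, show t - 1 + 1 = t by ring,
    Polynomial.Chebyshev.T_real_cos] at h1
  rw [Polynomial.Chebyshev.T_real_cos] at h2
  simp only [signKernel]
  rw [show t + 1 - 1 = t by ring, h1, h2]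
  ring

lemma integral_cos_int_mul {t : ℤ} (ht : t ≠ 0) :
    ∫ θ in (0 : ℝ)..Real.pi, Real.cos ((t : ℝ) * θ) = 0 := by
  have h : (t : ℝ) ≠ 0 := by exact_mod_cast ht
  rw [intervalIntegral.integral_comp_mul_left (fun y => Real.cos y) h]
  simp [Real.sin_int_mul_pi]

/-- Raising `t` adds only cosines of nonzero integer frequency, whose integrals over `[0, π]`
vanish. -/
lemma integral_signKernel {t : ℤ} (ht : 1 ≤ t) :
    ∫ θ in (0 : ℝ)..Real.pi, signKernel t θ = Real.pi := by
  induction t, ht using Int.leInduction with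
  | base =>
    simp only [signKernel_one]
    rw [intervalIntegral.integral_add (by simp) (Real.continuous_cos.intervalIntegrable _ _)]
    simp
  | succ t ht ih =>
    simp only [signKernel_add_one]
    rw [intervalIntegral.integral_add ((continuous_signKernel t).intervalIntegrable _ _)
      (Continuous.intervalIntegrable (by fun_prop) _ _),
      intervalIntegral.integral_add (Continuous.intervalIntegrable (by fun_prop) _ _)
      (Continuous.intervalIntegrable (by fun_prop) _ _),
      integral_cos_int_mul (by omega), integral_cos_int_mul (by omega), ih]
    simp

lemma meanSign_zero_left (α : ℕ → ℝ) {t : ℤ} (ht : 1 ≤ t) : meanSign α 0 t = 1 := by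
  simp [meanSign, lazyCharFun, integral_signKernel ht, Real.pi_ne_zero]

lemma meanSign_zero_right (α : ℕ → ℝ) (m : ℕ) : meanSign α m 0 = 0 := by
  simp [meanSign, signKernel_zero]

lemma intervalIntegrable_signKernel_mul (α : ℕ → ℝ) (m : ℕ) (t : ℤ) :
    IntervalIntegrable (fun θ => signKernel t θ * lazyCharFun α m θ)
      MeasureTheory.volume 0 Real.pi :=
  ((continuous_signKernel t).mul (continuous_lazyCharFun α m)).intervalIntegrable _ _

/-- Summing the kernel over the two neighbours of `t` multiplies it by `2 cos θ`, which matches the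
new factor of the characteristic function. -/
lemma meanSign_succ (α : ℕ → ℝ) (m : ℕ) (t : ℤ) :
    meanSign α (m + 1) t = (1 - 2 * (α (m + 1) * (1 - α (m + 1)))) * meanSign α m t
      + α (m + 1) * (1 - α (m + 1)) * (meanSign α m (t + 1) + meanSign α m (t - 1)) := by
  have h : ∀ θ, signKernel t θ * lazyCharFun α (m + 1) θ
      = (1 - 2 * (α (m + 1) * (1 - α (m + 1)))) * (signKernel t θ * lazyCharFun α m θ)
        + α (m + 1) * (1 - α (m + 1)) * (signKernel (t + 1) θ * lazyCharFun α m θ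
          + signKernel (t - 1) θ * lazyCharFun α m θ) := by
    intro θ
    rw [← add_mul, signKernel_add_signKernel, lazyCharFun,
      Finset.prod_Icc_succ_top (by omega), ← lazyCharFun]
    ring
  have I := intervalIntegrable_signKernel_mul α m
  simp only [meanSign, h]
  rw [intervalIntegral.integral_add ((I t).const_mul _) (((I _).add (I _)).const_mul _),
    intervalIntegral.integral_const_mul, intervalIntegral.integral_const_mul,
    intervalIntegral.integral_add (I _) (I _)]
  ring

/-- The symmetric step `m + 1` is `ξ - ξ'` with independent Bernoulli variables of parameter `α (m +
1)`: `ξ` joins the random initial position, and conditioning on `ξ'` gives the two terms. -/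
lemma raceProb_succ_left (α : ℕ → ℝ) (m k : ℕ) (t : ℤ) :
    raceProb α (m + 1) k t = (1 - α (m + 1)) * raceProb α m (k + 1) t
      + α (m + 1) * raceProb α m (k + 1) (t - 1) := by
  induction k generalizing t with
  | zero =>
    simp only [raceProb, meanSign_succ, add_zero, sub_add_cancel]
    ring
  | succ k ih =>
    have hs : ∀ s, raceProb α m (k + 1 + 1) s = (1 - α (m + (k + 1) + 1)) * raceProb α m (k + 1) s
      + α (m + (k + 1) + 1) * raceProb α m (k + 1) (s + 1) := fun _ => rfl
    rw [raceProb, ih, ih, hs, hs,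
      show m + 1 + k + 1 = m + (k + 1) + 1 by ring, show t + 1 - 1 = t by ring,
      show t - 1 + 1 = t by ring]
    ring

lemma raceProb_zero_left (α : ℕ → ℝ) (k : ℕ) {t : ℤ} (ht : 1 ≤ t) : raceProb α 0 k t = 1 := by
  induction k generalizing t with
  | zero => exact meanSign_zero_left α ht
  | succ k ih => rw [raceProb, ih ht, ih (by omega)]; ring

/-! ### Gaussian estimate of the expected sign -/

lemma lazyCharFun_factor_bounds {a : ℝ} (ha : a ∈ Set.Icc (0 : ℝ) 1) (θ : ℝ) :
    0 ≤ 2 * (a * (1 - a)) * (1 - Real.cos θ) ∧ 2 * (a * (1 - a)) * (1 - Real.cos θ) ≤ 1 := by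
  have h0 : 0 ≤ a * (1 - a) := mul_nonneg ha.1 (by linarith [ha.2])
  have h1 : a * (1 - a) ≤ 1 / 4 := by nlinarith [sq_nonneg (2 * a - 1)]
  have h2 := Real.cos_le_one θ
  have h3 := Real.neg_one_le_cos θ
  constructor
  · exact mul_nonneg (by linarith) (by linarith)
  · nlinarith

lemma lazyCharFun_le_exp {α : ℕ → ℝ} (hα : ∀ n, 1 ≤ n → α n ∈ Set.Icc (0 : ℝ) 1)
    (m : ℕ) (θ : ℝ) :
    lazyCharFun α m θ ≤ Real.exp (-(2 * tau α m * (1 - Real.cos θ))) := by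
  have h : -(2 * tau α m * (1 - Real.cos θ))
      = ∑ i ∈ Finset.Icc 1 m, -(2 * (α i * (1 - α i)) * (1 - Real.cos θ)) := by
    rw [tau, Finset.sum_neg_distrib, Finset.mul_sum, Finset.sum_mul]
  rw [h, Real.exp_sum, lazyCharFun]
  refine Finset.prod_le_prod (fun i hi => ?_) (fun i _ => Real.one_sub_le_exp_neg _)
  linarith [(lazyCharFun_factor_bounds (hα i (Finset.mem_Icc.1 hi).1) θ).2]

lemma lazyCharFun_le_one {α : ℕ → ℝ} (hα : ∀ n, 1 ≤ n → α n ∈ Set.Icc (0 : ℝ) 1)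
    (m : ℕ) (θ : ℝ) : lazyCharFun α m θ ≤ 1 := by
  refine Finset.prod_le_one (fun i hi => ?_) (fun i hi => ?_) <;>
    linarith [lazyCharFun_factor_bounds (hα i (Finset.mem_Icc.1 hi).1) θ]

lemma meanSign_one_le_one {α : ℕ → ℝ} (hα : ∀ n, 1 ≤ n → α n ∈ Set.Icc (0 : ℝ) 1) (m : ℕ) :
    meanSign α m 1 ≤ 1 := by
  have h : ∫ θ in (0 : ℝ)..Real.pi, signKernel 1 θ * lazyCharFun α m θ ≤ Real.pi := by
    refine le_of_le_of_eq ?_ (integral_signKernel le_rfl)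
    refine intervalIntegral.integral_mono_on Real.pi_pos.le
      (intervalIntegrable_signKernel_mul α m 1)
      ((continuous_signKernel 1).intervalIntegrable _ _) fun θ _ => ?_
    refine mul_le_of_le_one_right ?_ (lazyCharFun_le_one hα m θ)
    rw [signKernel_one]
    linarith [Real.neg_one_le_cos θ]
  rw [meanSign, inv_mul_le_iff₀ Real.pi_pos, mul_one]
  exact h

/-- Substitute `u = sin (θ / 2)` and extend the integral from `[0, 1]` to the half-line. -/
lemma integral_cos_half_mul_exp_le {y : ℝ} (hy : 0 < y) :
    ∫ θ in (0 : ℝ)..Real.pi, 2 * Real.cos (θ / 2) * Real.exp (-(4 * y) * Real.sin (θ / 2) ^ 2)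
      ≤ 2 * Real.sqrt (Real.pi / (4 * y)) := by
  have hsub : ∫ θ in (0 : ℝ)..Real.pi,
      ((fun u : ℝ => 4 * Real.exp (-(4 * y) * u ^ 2)) ∘ fun θ => Real.sin (θ / 2)) θ
        * (Real.cos (θ / 2) * (1 / 2))
      = ∫ u in Real.sin (0 / 2)..Real.sin (Real.pi / 2), 4 * Real.exp (-(4 * y) * u ^ 2) := by
    refine intervalIntegral.integral_comp_mul_deriv (fun θ _ => ?_) (by fun_prop) (by fun_prop)
    exact ((hasDerivAt_id θ).div_const 2).sin
  have hle : ∫ u in (0 : ℝ)..1, Real.exp (-(4 * y) * u ^ 2)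
      ≤ Real.sqrt (Real.pi / (4 * y)) / 2 := by
    rw [← integral_gaussian_Ioi, intervalIntegral.integral_of_le zero_le_one]
    exact MeasureTheory.setIntegral_mono_set
      (integrable_exp_neg_mul_sq (by positivity)).integrableOn
      (Eventually.of_forall fun u => (Real.exp_pos _).le)
      (LE.le.eventuallyLE Set.Ioc_subset_Ioi_self)
  have heq : ∫ θ in (0 : ℝ)..Real.pi,
      2 * Real.cos (θ / 2) * Real.exp (-(4 * y) * Real.sin (θ / 2) ^ 2)
      = 4 * ∫ u in (0 : ℝ)..1, Real.exp (-(4 * y) * u ^ 2) := by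
    rw [← intervalIntegral.integral_const_mul]
    simp only [zero_div, Real.sin_zero, Real.sin_pi_div_two] at hsub
    rw [← hsub]
    congr 1
    ext θ
    simp only [Function.comp]
    ring
  rw [heq]
  linarith

lemma meanSign_one_le {α : ℕ → ℝ} (hα : ∀ n, 1 ≤ n → α n ∈ Set.Icc (0 : ℝ) 1) {m : ℕ}
    (hτ : 0 < tau α m) : meanSign α m 1 ≤ 1 / Real.sqrt (Real.pi * tau α m) := by
  have h : ∫ θ in (0 : ℝ)..Real.pi, signKernel 1 θ * lazyCharFun α m θ
      ≤ 2 * Real.sqrt (Real.pi / (4 * tau α m)) := by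
    refine le_trans ?_ (integral_cos_half_mul_exp_le hτ)
    refine intervalIntegral.integral_mono_on Real.pi_pos.le
      (intervalIntegrable_signKernel_mul α m 1)
      (Continuous.intervalIntegrable (by fun_prop) _ _) fun θ hθ => ?_
    have hc : 0 ≤ Real.cos (θ / 2) :=
      Real.cos_nonneg_of_mem_Icc ⟨by linarith [hθ.1, Real.pi_pos], by linarith [hθ.2]⟩
    have hcos : Real.cos θ = 2 * Real.cos (θ / 2) ^ 2 - 1 := by
      rw [← Real.cos_two_mul]; congr 1; ring
    have hexp := lazyCharFun_le_exp hα m θ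
    rw [show -(2 * tau α m * (1 - Real.cos θ)) = -(4 * tau α m) * Real.sin (θ / 2) ^ 2 by
      rw [hcos, Real.sin_sq]; ring] at hexp
    rw [signKernel_one]
    refine (mul_le_mul_of_nonneg_left hexp (by linarith [Real.neg_one_le_cos θ])).trans ?_
    -- Bounding `1 + cos θ = 2 cos² (θ / 2)` by `2 cos (θ / 2)` leaves exactly the derivative needed
    -- for the substitution.
    refine mul_le_mul_of_nonneg_right ?_ (Real.exp_pos _).le
    nlinarith [Real.cos_le_one (θ / 2)]
  rw [meanSign, inv_mul_le_iff₀ Real.pi_pos]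
  refine h.trans (le_of_eq ?_)
  have hp := Real.pi_pos
  have hs : Real.sqrt (4 * tau α m) = 2 * Real.sqrt (tau α m) := by
    rw [Real.sqrt_mul (by norm_num), show (4 : ℝ) = 2 ^ 2 by norm_num,
      Real.sqrt_sq (by norm_num)]
  rw [Real.sqrt_div hp.le, hs, Real.sqrt_mul hp.le]
  have h1 : Real.sqrt Real.pi ≠ 0 := (Real.sqrt_pos.2 hp).ne'
  have h2 : Real.sqrt (tau α m) ≠ 0 := (Real.sqrt_pos.2 hτ).ne'
  field_simp
  exact Real.sq_sqrt hp.le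

lemma tau_nonneg {α : ℕ → ℝ} (hα : ∀ n, 1 ≤ n → α n ∈ Set.Icc (0 : ℝ) 1) (m : ℕ) :
    0 ≤ tau α m :=
  Finset.sum_nonneg fun i hi => by
    have := hα i (Finset.mem_Icc.1 hi).1
    exact mul_nonneg this.1 (by linarith [this.2])

lemma raceProb_zero_one_le_sigma {α : ℕ → ℝ} (hα : ∀ n, 1 ≤ n → α n ∈ Set.Icc (0 : ℝ) 1)
    (m : ℕ) : raceProb α m 0 1 ≤ sigma (tau α m) := by
  rw [raceProb, sigma]
  split_ifs with h
  · exact meanSign_one_le_one hα m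
  · exact le_min (meanSign_one_le_one hα m)
      (meanSign_one_le hα (lt_of_le_of_ne (tau_nonneg hα m) (Ne.symm h)))

lemma tau_shift (α : ℕ → ℝ) (i k : ℕ) :
    tau (fun j => α (i + j)) k = tau α (i + k) - tau α i := by
  induction k with
  | zero => simp [tau]
  | succ k ih =>
    have h : ∀ (β : ℕ → ℝ) (n : ℕ), tau β (n + 1) = tau β n + β (n + 1) * (1 - β (n + 1)) :=
      fun β n => Finset.sum_Icc_succ_top (by omega) _
    rw [h, ih, ← add_assoc, h]
    ring

lemma sigma_nonneg (y : ℝ) : 0 ≤ sigma y := by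
  rw [sigma]; split_ifs <;> positivity

lemma sigma_le_one (y : ℝ) : sigma y ≤ 1 := by
  rw [sigma]; split_ifs
  · exact le_rfl
  · exact min_le_left _ _

lemma tendsto_sigma_atTop : Tendsto sigma atTop (𝓝 0) := by
  have h : Tendsto (fun y : ℝ => 1 / Real.sqrt (Real.pi * y)) atTop (𝓝 0) := by
    simp only [one_div]
    exact tendsto_inv_atTop_zero.comp
      (Real.tendsto_sqrt_atTop.comp (tendsto_id.const_mul_atTop Real.pi_pos))
  refine squeeze_zero' (Eventually.of_forall sigma_nonneg) ?_ h
  filter_upwards [eventually_gt_atTop 0] with y hy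
  rw [sigma, if_neg hy.ne']
  exact min_le_right _ _

/-! ### The comparison recursion with errors -/

/-- The bound for the distance of `x_m` to `T x_{m+k}` (`t = 1`) or to `x_{m+k}` (`t = 0`) in an
iteration whose `i`-th step is perturbed by at most `e_i`. -/
noncomputable def raceBound (κ : ℝ) (α e : ℕ → ℝ) (m k : ℕ) (t : ℤ) : ℝ :=
  κ * raceProb α m k t
    + ∑ i ∈ Finset.Icc 1 m, 2 * e i * raceProb (fun j => α (i + j)) (m - i) k t
    + ∑ i ∈ Finset.Ioc m (m + k), e i

lemma raceBound_zero_right (κ : ℝ) (α e : ℕ → ℝ) (m : ℕ) : raceBound κ α e m 0 0 = 0 := by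
  simp [raceBound, raceProb, meanSign_zero_right]

lemma raceBound_succ_right (κ : ℝ) (α e : ℕ → ℝ) (m k : ℕ) (t : ℤ) :
    raceBound κ α e m (k + 1) t = (1 - α (m + k + 1)) * raceBound κ α e m k t
      + α (m + k + 1) * raceBound κ α e m k (t + 1) + e (m + k + 1) := by
  have h : ∑ i ∈ Finset.Icc 1 m, 2 * e i * raceProb (fun j => α (i + j)) (m - i) (k + 1) t
      = (1 - α (m + k + 1)) *
          ∑ i ∈ Finset.Icc 1 m, 2 * e i * raceProb (fun j => α (i + j)) (m - i) k t
        + α (m + k + 1) *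
          ∑ i ∈ Finset.Icc 1 m, 2 * e i * raceProb (fun j => α (i + j)) (m - i) k (t + 1) := by
    rw [Finset.mul_sum, Finset.mul_sum, ← Finset.sum_add_distrib]
    refine Finset.sum_congr rfl fun i hi => ?_
    have := (Finset.mem_Icc.1 hi).2
    rw [raceProb, show i + (m - i + k + 1) = m + k + 1 by omega]
    ring
  simp only [raceBound]
  rw [h, raceProb, ← add_assoc m k 1, Finset.sum_Ioc_succ_top (by omega)]
  ring

/-- The factor `2` arises here: `e (m + 1)` occurs once in the tail sum, from moving the later
iterate, and once more from moving `x m` itself. -/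
lemma raceBound_succ_left (κ : ℝ) (α e : ℕ → ℝ) (m k : ℕ) :
    raceBound κ α e (m + 1) k 1 = (1 - α (m + 1)) * raceBound κ α e m (k + 1) 1
      + α (m + 1) * raceBound κ α e m (k + 1) 0 + e (m + 1) := by
  have h : ∑ i ∈ Finset.Icc 1 m, 2 * e i * raceProb (fun j => α (i + j)) (m + 1 - i) k 1
      = (1 - α (m + 1)) *
          ∑ i ∈ Finset.Icc 1 m, 2 * e i * raceProb (fun j => α (i + j)) (m - i) (k + 1) 1
        + α (m + 1) *
          ∑ i ∈ Finset.Icc 1 m, 2 * e i * raceProb (fun j => α (i + j)) (m - i) (k + 1) 0 := by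
    rw [Finset.mul_sum, Finset.mul_sum, ← Finset.sum_add_distrib]
    refine Finset.sum_congr rfl fun i hi => ?_
    have := (Finset.mem_Icc.1 hi).2
    rw [show m + 1 - i = m - i + 1 by omega, raceProb_succ_left,
      show i + (m - i + 1) = m + 1 by omega, sub_self]
    ring
  have hs : ∑ i ∈ Finset.Ioc m (m + (k + 1)), e i
      = e (m + 1) + ∑ i ∈ Finset.Ioc (m + 1) (m + 1 + k), e i := by
    rw [show m + (k + 1) = m + 1 + k by ring, ← Finset.sum_Ioc_consecutive e
      (Nat.le_succ m) (Nat.le_add_right (m + 1) k)]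
    simp
  simp only [raceBound]
  rw [Finset.sum_Icc_succ_top (by omega), h, hs, raceProb_succ_left, Nat.sub_self,
    raceProb_zero_left _ k le_rfl, sub_self]
  ring

lemma raceBound_zero_left (κ : ℝ) (α e : ℕ → ℝ) (k : ℕ) :
    raceBound κ α e 0 k 1 = κ + ∑ i ∈ Finset.Ioc 0 k, e i := by
  simp [raceBound, raceProb_zero_left]

/-! ### Domination of the iterates -/

section Iteration

variable {E : Type*} [NormedAddCommGroup E] [NormedSpace ℝ E]

lemma IsDiagonalKM.mem {C : Set E} (hC : Convex ℝ C) {Tseq : ℕ → E → E}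
    (hTseqC : ∀ n : ℕ, 1 ≤ n → Set.MapsTo (Tseq n) C C)
    {α : ℕ → ℝ} (hα : ∀ n : ℕ, 1 ≤ n → α n ∈ Set.Icc (0 : ℝ) 1)
    {x : ℕ → E} (hx0 : x 0 ∈ C) (hx : IsDiagonalKM α Tseq x) (n : ℕ) : x n ∈ C := by
  induction n with
  | zero => exact hx0
  | succ n ih =>
    rw [hx n]
    have ha := hα (n + 1) (by omega)
    exact hC ih (hTseqC (n + 1) (by omega) ih) (by linarith [ha.2]) ha.1 (by ring)

lemma IsDiagonalKM.norm_sub_le {T : E → E} {Tseq : ℕ → E → E}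
    {α e : ℕ → ℝ} (hα : ∀ n : ℕ, 1 ≤ n → α n ∈ Set.Icc (0 : ℝ) 1)
    {x : ℕ → E} (hx : IsDiagonalKM α Tseq x)
    (he : ∀ n, α (n + 1) * ‖Tseq (n + 1) (x n) - T (x n)‖ ≤ e (n + 1)) (n : ℕ) (z : E) :
    ‖x (n + 1) - z‖ ≤ (1 - α (n + 1)) * ‖x n - z‖ + α (n + 1) * ‖T (x n) - z‖ + e (n + 1) := by
  have ha := hα (n + 1) (by omega)
  have h : x (n + 1) - z = (1 - α (n + 1)) • (x n - z) + α (n + 1) • (T (x n) - z)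
      + α (n + 1) • (Tseq (n + 1) (x n) - T (x n)) := by
    rw [hx n]; module
  rw [h]
  refine (norm_add₃_le).trans ?_
  rw [norm_smul, norm_smul, norm_smul, Real.norm_of_nonneg ha.1,
    Real.norm_of_nonneg (by linarith [ha.2])]
  linarith [he n]

/-- For fixed `m`, moving the later iterate deduces the case `t = 0` from `t = 1`. Moving `x m`,
with `hT` applied to `T (x m)`, then gives `t = 1` for `m + 1`. -/
lemma IsDiagonalKM.norm_le_raceBound {T : E → E} {Tseq : ℕ → E → E}
    {α e : ℕ → ℝ} (hα : ∀ n : ℕ, 1 ≤ n → α n ∈ Set.Icc (0 : ℝ) 1)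
    {x : ℕ → E} (hx : IsDiagonalKM α Tseq x)
    (hT : ∀ m n, ‖T (x m) - T (x n)‖ ≤ ‖x m - x n‖)
    (he0 : ∀ n, 1 ≤ n → 0 ≤ e n)
    (he : ∀ n, α (n + 1) * ‖Tseq (n + 1) (x n) - T (x n)‖ ≤ e (n + 1))
    {κ : ℝ} (hκ : ∀ n : ℕ, ‖x 0 - T (x n)‖ ≤ κ) (m k : ℕ) :
    ‖x m - T (x (m + k))‖ ≤ raceBound κ α e m k 1 ∧
      ‖x m - x (m + k)‖ ≤ raceBound κ α e m k 0 := by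
  have hstep : ∀ m, (∀ k, ‖x m - T (x (m + k))‖ ≤ raceBound κ α e m k 1) →
      ∀ k, ‖x m - x (m + k)‖ ≤ raceBound κ α e m k 0 := by
    intro m hm k
    induction k with
    | zero => simp [raceBound_zero_right]
    | succ k ih =>
      have ha := hα (m + k + 1) (by omega)
      have h := hx.norm_sub_le hα he (m + k) (x m)
      rw [norm_sub_rev, norm_sub_rev _ (x m), norm_sub_rev _ (x m)] at h
      rw [raceBound_succ_right, ← add_assoc, zero_add]
      have h1 := mul_le_mul_of_nonneg_left ih (sub_nonneg.2 ha.2)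
      have h2 := mul_le_mul_of_nonneg_left (hm k) ha.1
      linarith
  suffices h : ∀ k, ‖x m - T (x (m + k))‖ ≤ raceBound κ α e m k 1 from ⟨h k, hstep m h k⟩
  clear k
  induction m with
  | zero =>
    intro k
    rw [raceBound_zero_left, zero_add]
    have : 0 ≤ ∑ i ∈ Finset.Ioc 0 k, e i :=
      Finset.sum_nonneg fun i hi => he0 i (Finset.mem_Ioc.1 hi).1
    linarith [hκ k]
  | succ m ih =>
    intro k
    have ha := hα (m + 1) (by omega)
    have h := hx.norm_sub_le hα he m (T (x (m + 1 + k)))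
    rw [raceBound_succ_left]
    have h1 := ih (k + 1)
    have h2 := (hT m (m + 1 + k)).trans
      (le_of_eq_of_le (by rw [show m + 1 + k = m + (k + 1) by ring]) (hstep m ih (k + 1)))
    rw [show m + (k + 1) = m + 1 + k by ring] at h1
    have h1 := mul_le_mul_of_nonneg_left h1 (sub_nonneg.2 ha.2)
    have h2 := mul_le_mul_of_nonneg_left h2 ha.1
    linarith

lemma raceBound_le {α e : ℕ → ℝ} (hα : ∀ n : ℕ, 1 ≤ n → α n ∈ Set.Icc (0 : ℝ) 1)
    (he0 : ∀ n, 1 ≤ n → 0 ≤ e n) {κ : ℝ} (hκ0 : 0 ≤ κ) (n : ℕ) :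
    raceBound κ α e n 0 1 ≤ κ * sigma (tau α n)
      + ∑ i ∈ Finset.Icc 1 n, 2 * e i * sigma (tau α n - tau α i) := by
  rw [raceBound, add_zero, Finset.Ioc_self, Finset.sum_empty, add_zero]
  refine add_le_add (mul_le_mul_of_nonneg_left (raceProb_zero_one_le_sigma hα n) hκ0)
    (Finset.sum_le_sum fun i hi => ?_)
  obtain ⟨h1, h2⟩ := Finset.mem_Icc.1 hi
  have h := raceProb_zero_one_le_sigma (α := fun j => α (i + j))
    (fun j _ => hα (i + j) (by omega)) (n - i)
  rw [tau_shift, Nat.add_sub_cancel' h2] at h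
  exact mul_le_mul_of_nonneg_left h (by linarith [he0 i h1])

end Iteration

/-- Each term tends to zero because `tau α` diverges, and `σ ≤ 1` makes `2 * e (i + 1)` a summable
majorant. -/
lemma tendsto_sum_mul_sigma {α e : ℕ → ℝ} (hτ : Tendsto (tau α) atTop atTop)
    (he0 : ∀ n, 1 ≤ n → 0 ≤ e n) (he : Summable fun n => e (n + 1)) :
    Tendsto (fun n => ∑ i ∈ Finset.Icc 1 n, 2 * e i * sigma (tau α n - tau α i)) atTop (𝓝 0) := by
  have h : ∀ n, ∑ i ∈ Finset.Icc 1 n, 2 * e i * sigma (tau α n - tau α i)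
      = ∑' i, (Finset.range n : Set ℕ).indicator
        (fun i => 2 * e (i + 1) * sigma (tau α n - tau α (i + 1))) i := by
    intro n
    rw [← sum_eq_tsum_indicator, ← Finset.Ico_succ_right_eq_Icc, Finset.sum_Ico_eq_sum_range]
    simp [add_comm]
  simp only [h]
  rw [show (0 : ℝ) = ∑' _ : ℕ, (0 : ℝ) from tsum_zero.symm]
  refine tendsto_tsum_of_dominated_convergence (bound := fun i => 2 * e (i + 1))
    (he.mul_left 2) (fun i => ?_) (Eventually.of_forall fun n i => ?_)
  · have hlim : Tendsto (fun n => 2 * e (i + 1) * sigma (tau α n - tau α (i + 1))) atTop (𝓝 0) := by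
      have := (tendsto_sigma_atTop.comp
        (tendsto_atTop_add_const_right _ (-tau α (i + 1)) hτ)).const_mul
        (2 * e (i + 1))
      simpa [Function.comp_def, sub_eq_add_neg] using this
    refine hlim.congr' ?_
    filter_upwards [eventually_gt_atTop i] with n hn
    rw [Set.indicator_of_mem (by simpa using hn)]
  · have h2 : 0 ≤ 2 * e (i + 1) := by linarith [he0 (i + 1) (by omega)]
    refine (norm_indicator_le_norm_self _ _).trans ?_
    rw [Real.norm_of_nonneg (mul_nonneg h2 (sigma_nonneg _))]
    exact mul_le_of_le_one_right h2 (sigma_le_one _)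

end DiagKM

theorem mainTheorem7 {E : Type*} [NormedAddCommGroup E] [NormedSpace ℝ E]
    (C : Set E) (hC : Convex ℝ C)
    (T : E → E) (hTC : Set.MapsTo T C C) (hT : LipschitzOnWith 1 T C)
    (Tseq : ℕ → E → E)
    (hTseqC : ∀ n : ℕ, 1 ≤ n → Set.MapsTo (Tseq n) C C)
    (hTseq : ∀ n : ℕ, 1 ≤ n → LipschitzOnWith 1 (Tseq n) C)
    (α : ℕ → ℝ) (hα : ∀ n : ℕ, 1 ≤ n → α n ∈ Set.Icc (0 : ℝ) 1)
    (x : ℕ → E) (hx0 : x 0 ∈ C) (hx : DiagKM.IsDiagonalKM α Tseq x)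
    (ρ : ℕ → ℝ≥0∞) (hρ : ∀ n : ℕ, 1 ≤ n → ρ n = DiagKM.unifDist C (Tseq n) T)
    (hρ0 : Tendsto ρ atTop (𝓝 0))
    (hsum : ∑' k : ℕ, ENNReal.ofReal (α (k + 1)) * ρ (k + 1) < ∞)
    (hτ : Tendsto (DiagKM.tau α) atTop atTop)
    (κ : ℝ) (hκ0 : 0 ≤ κ) (hκ : ∀ n : ℕ, ‖x 0 - T (x n)‖ ≤ κ) :
    Tendsto (fun n => ‖x n - T (x n)‖) atTop (𝓝 0) ∧
      ∀ n : ℕ, ENNReal.ofReal ‖x n - T (x n)‖ ≤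
        ENNReal.ofReal (κ * DiagKM.sigma (DiagKM.tau α n))
          + ∑ i ∈ Finset.Icc 1 n,
              2 * ENNReal.ofReal (α i) * ρ i *
                ENNReal.ofReal (DiagKM.sigma (DiagKM.tau α n - DiagKM.tau α i))
          + 2 * ρ (n + 1) := by
  -- `ρ n` may be infinite where `α n = 0`; the product is still finite, so real-valued errors
  -- suffice.
  set e : ℕ → ℝ := fun n => (ENNReal.ofReal (α n) * ρ n).toReal with he_def
  have hfin : ∀ n, 1 ≤ n → ENNReal.ofReal (α n) * ρ n ≠ ∞ := by
    intro n hn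
    obtain ⟨k, rfl⟩ := Nat.exists_eq_add_of_le' hn
    exact ENNReal.ne_top_of_tsum_ne_top hsum.ne k
  have he0 : ∀ n, 1 ≤ n → 0 ≤ e n := fun n _ => ENNReal.toReal_nonneg
  have hmem := hx.mem hC hTseqC hα hx0
  have he : ∀ n, α (n + 1) * ‖Tseq (n + 1) (x n) - T (x n)‖ ≤ e (n + 1) := by
    intro n
    have ha := (hα (n + 1) (by omega)).1
    rw [he_def, ← ENNReal.ofReal_le_iff_le_toReal (hfin (n + 1) (by omega)),
      ENNReal.ofReal_mul ha, hρ (n + 1) (by omega)]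
    gcongr
    exact le_iSup₂ (f := fun y (_ : y ∈ C) => ENNReal.ofReal ‖Tseq (n + 1) y - T y‖) (x n) (hmem n)
  have hTx : ∀ m n, ‖T (x m) - T (x n)‖ ≤ ‖x m - x n‖ := by
    intro m n
    simpa using hT.norm_sub_le (hmem m) (hmem n)
  have hbound : ∀ n, ‖x n - T (x n)‖ ≤ κ * DiagKM.sigma (DiagKM.tau α n)
      + ∑ i ∈ Finset.Icc 1 n, 2 * e i * DiagKM.sigma (DiagKM.tau α n - DiagKM.tau α i) :=
    fun n => ((hx.norm_le_raceBound hα hTx he0 he hκ n 0).1).trans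
      (DiagKM.raceBound_le hα he0 hκ0 n)
  constructor
  · refine squeeze_zero (fun n => norm_nonneg _) hbound ?_
    have h1 := (DiagKM.tendsto_sigma_atTop.comp hτ).const_mul κ
    have h2 := DiagKM.tendsto_sum_mul_sigma hτ he0 (ENNReal.summable_toReal hsum.ne)
    simpa using h1.add h2
  · intro n
    -- The estimate holds even without the term `2 * ρ (n + 1)`.
    refine le_trans ?_ le_self_add
    refine (ENNReal.ofReal_le_ofReal (hbound n)).trans (ENNReal.ofReal_add_le.trans ?_)
    gcongr
    rw [ENNReal.ofReal_sum_of_nonneg fun i hi => mul_nonneg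
      (by linarith [he0 i (Finset.mem_Icc.1 hi).1]) (DiagKM.sigma_nonneg _)]
    refine Finset.sum_le_sum fun i hi => le_of_eq ?_
    have hi1 := (Finset.mem_Icc.1 hi).1
    rw [ENNReal.ofReal_mul (by linarith [he0 i hi1]), ENNReal.ofReal_mul zero_le_two, he_def,
      ENNReal.ofReal_toReal (hfin i hi1), mul_assoc 2 (ENNReal.ofReal (α i)), ENNReal.ofReal_ofNat]
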